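/- Let $\mathrm{Int}(\mathbb Z)=\{f\in\mathbb Q[X] : f(\mathbb Z)\subseteq\mathbb Z\}$. A *polynomial overring* of $\mathrm{Int}(\mathbb Z)$ is a ring $R$ with $\mathrm{Int}(\mathbb Z)\subseteq R\subseteq\mathbb Q[X]$; let $\mathcal R$ be the set of these. For a prime $p$ and $\alpha\in\mathbb Z_p$ let $\mathfrak M_{p,\alpha}=\{f\in\mathrm{Int}(\mathbb Z) : f(\alpha)\in p\mathbb Z_p\}$, an ideal of $\mathrm{Int}(\mathbb Z)$, and for $R\in\mathcal R$ let $Z_p(R)=\{\alpha\in\mathbb Z_p : \mathfrak M_{p,\alpha}R\subsetneq R\}$. For $E\subseteq\mathbb Z_p$ let $\mathrm{Int}_{\mathbb Q}(E,\mathbb Z_p)=\{f\in\mathbb Q[X] : f(E)\subseteq\mathbb Z_p\}$, which is $\mathbb Q[X]$ if $E=\emptyset$. Let $\widehat{\mathbb Z}=\prod_p\mathbb Z_p$ with the product topology, and for $\underline E\subseteq\widehat{\mathbb Z}$ let $\mathrm{Int}_{\mathbb Q}(\underline E,\widehat{\mathbb Z})=\{f\in\mathbb Q[X] : (f(\alpha_p))_p\in\widehat{\mathbb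 Z}\text{ for all }(\alpha_p)_p\in\underline E\}$. 1. (Formal products.) The maps $$R\mapsto (Z_p(R))_p,\qquad (F_p)_p\mapsto\bigcap_p\mathrm{Int}_{\mathbb Q}(F_p,\mathbb Z_p)$$ are mutually inverse, inclusion-reversing bijections between $\mathcal R$ and the set of all families $(F_p)_p$ of (possibly empty) closed subsets $F_p\subseteq\mathbb Z_p$, ordered by componentwise inclusion; inclusions are reversed in both directions. 2. If $F_p\subseteq\mathbb Z_p$ is non-empty for every prime $p$, then $\mathrm{Int}_{\mathbb Q}(\prod_pF_p,\widehat{\mathbb Z})=\bigcap_p\mathrm{Int}_{\mathbb Q}(F_p,\mathbb Z_p)$. 3. (Subsets of $\widehat{\mathbb Z}$.) Let $\mathcal F(\widehat{\mathbb Z})$ be the family of all compact subsets of $\widehat{\mathbb Z}$ of the form $\prod_pF_p$ with each $F_p$ closed in $\mathbb Z_p$, and let $\mathcal R'$ be the set of those $R\in\mathcal R$ for which $R=\mathbb Q[X]$ or $Z_p(R)\neq\emptyset$ for every prime $p$. The maps $$R\mapsto\prod_pZ_p(R),\qquad \underline F\mapsto\mathrm{Int}_{\mathbb Q}(\underline F,\widehat{\mathbb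 Z})$$ are mutually inverse, inclusion-reversing bijections between $\mathcal R'$ and $\mathcal F(\widehat{\mathbb Z})$; inclusions are reversed in both directions. 4. A polynomial overring $R$ of $\mathrm{Int}(\mathbb Z)$ is of the form $\mathrm{Int}_{\mathbb Q}(\underline E,\widehat{\mathbb Z})$ for some subset $\underline E\subseteq\widehat{\mathbb Z}$ if and only if $R=\mathbb Q[X]$ or $Z_p(R)\neq\emptyset$ for every prime $p$. -/

import Mathlib

open Polynomial

namespace IntPoly

/-- A prime number, seen as an element of `Nat.Primes`, is prime. -/
instance factPrime (p : Nat.Primes) : Fact (p : ℕ).Prime := ⟨p.2⟩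

/-- `Int(ℤ) = {f ∈ ℚ[X] | f(ℤ) ⊆ ℤ}`. -/
def intZ : Subring ℚ[X] where
  carrier := {f | ∀ n : ℤ, ∃ m : ℤ, f.eval (n : ℚ) = m}
  mul_mem' := by
    intro f g hf hg n
    obtain ⟨a, ha⟩ := hf n
    obtain ⟨b, hb⟩ := hg n
    exact ⟨a * b, by simp [ha, hb]⟩
  one_mem' := fun _ => ⟨1, by simp⟩
  add_mem' := by
    intro f g hf hg n
    obtain ⟨a, ha⟩ := hf n
    obtain ⟨b, hb⟩ := hg n
    exact ⟨a + b, by simp [ha, hb]⟩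
  zero_mem' := fun _ => ⟨0, by simp⟩
  neg_mem' := by
    intro f hf n
    obtain ⟨a, ha⟩ := hf n
    exact ⟨-a, by simp [ha]⟩

/-- The polynomial overrings of `Int(ℤ)`: the rings `R` with `Int(ℤ) ⊆ R ⊆ ℚ[X]`,
ordered by inclusion. -/
abbrev PolyOverring : Type := {R : Subring ℚ[X] // intZ ≤ R}

/-- A polynomial in `Int(ℤ)` maps `ℤ_p` into `ℤ_p`. -/
theorem aeval_mem_of_mem_intZ (p : ℕ) [Fact p.Prime] {f : ℚ[X]} (hf : f ∈ intZ) (α : ℤ_[p]) :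
    aeval (α : ℚ_[p]) f ∈ PadicInt.subring p := by
  have hcont : Continuous fun β : ℤ_[p] => aeval (β : ℚ_[p]) f :=
    f.continuous_aeval.comp continuous_subtype_val
  have hclosed : IsClosed {β : ℤ_[p] | ‖aeval (β : ℚ_[p]) f‖ ≤ 1} :=
    isClosed_le hcont.norm continuous_const
  have hdense : DenseRange (Int.cast : ℤ → ℤ_[p]) := PadicInt.denseRange_intCast
  refine hdense.induction_on (p := fun β => ‖aeval (β : ℚ_[p]) f‖ ≤ 1) α hclosed ?_
  intro n
  obtain ⟨m, hm⟩ := hf n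
  have h : aeval (((n : ℤ_[p]) : ℚ_[p])) f = ((m : ℤ) : ℚ_[p]) := by
    have h1 : (((n : ℤ_[p]) : ℚ_[p])) = algebraMap ℚ ℚ_[p] (n : ℚ) := by simp
    rw [h1, aeval_algebraMap_apply, coe_aeval_eq_eval, hm]
    simp
  rw [h]
  exact Padic.norm_int_le_one m

/-- The prime ideal `𝔐_{p,α} = {f ∈ Int(ℤ) | f(α) ∈ p ℤ_p}` of `Int(ℤ)`. -/
def idealM (p : ℕ) [Fact p.Prime] (α : ℤ_[p]) : Ideal intZ where
  carrier := {f | ∃ β : ℤ_[p],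
    aeval (α : ℚ_[p]) (f : ℚ[X]) = (p : ℚ_[p]) * β}
  add_mem' := by
    rintro f g ⟨a, ha⟩ ⟨b, hb⟩
    exact ⟨a + b, by simp [ha, hb, mul_add]⟩
  zero_mem' := ⟨0, by simp⟩
  smul_mem' := by
    rintro c f ⟨a, ha⟩
    let b : ℤ_[p] := ⟨_, aeval_mem_of_mem_intZ p c.2 α⟩
    have hb : (b : ℚ_[p]) = aeval (α : ℚ_[p]) (c : ℚ[X]) := rfl
    refine ⟨b * a, ?_⟩
    have h : aeval (α : ℚ_[p]) ((c • f : intZ) : ℚ[X]) =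
        aeval (α : ℚ_[p]) (c : ℚ[X]) * aeval (α : ℚ_[p]) (f : ℚ[X]) := by
      rw [← map_mul]; rfl
    rw [h, ha, PadicInt.coe_mul, hb, mul_left_comm]

/-- `Z_p(R) = {α ∈ ℤ_p | 𝔐_{p,α} R ⊊ R}`. -/
def Zp (p : ℕ) [Fact p.Prime] (R : PolyOverring) : Set ℤ_[p] :=
  {α | (idealM p α).map (Subring.inclusion R.2) ≠ ⊤}

/-- `Int_ℚ(E, ℤ_p) = {f ∈ ℚ[X] | f(E) ⊆ ℤ_p}` for `E ⊆ ℤ_p`. -/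
noncomputable def intQp (p : ℕ) [Fact p.Prime] (E : Set ℤ_[p]) : Subring ℚ[X] where
  carrier := {f | ∀ α ∈ E, aeval (α : ℚ_[p]) f ∈ PadicInt.subring p}
  mul_mem' hf hg α hα := by
    rw [map_mul]; exact mul_mem (hf α hα) (hg α hα)
  one_mem' α _ := by rw [map_one]; exact one_mem _
  add_mem' hf hg α hα := by
    rw [map_add]; exact add_mem (hf α hα) (hg α hα)
  zero_mem' α _ := by rw [map_zero]; exact zero_mem _
  neg_mem' hf α hα := by
    rw [map_neg]; exact neg_mem (hf α hα)

/-- The ring of polynomials that are integer-valued on a formal product `∏_p F_p` (a family of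
sets `F_p ⊆ ℤ_p`, some of which may be empty): the intersection of the `Int_ℚ(F_p, ℤ_p)`. -/
noncomputable def intFamily (F : ∀ p : Nat.Primes, Set ℤ_[(p : ℕ)]) : Subring ℚ[X] :=
  ⨅ p : Nat.Primes, intQp p (F p)

/-- `Ẑ = ∏_p ℤ_p`, with the product topology. -/
abbrev ZHat : Type := ∀ p : Nat.Primes, ℤ_[(p : ℕ)]

/-- `Int_ℚ(E, Ẑ) = {f ∈ ℚ[X] | f(α) = (f(α_p))_p ∈ Ẑ for all α ∈ E}` for a subset `E` of `Ẑ`. -/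
noncomputable def intQHat (E : Set ZHat) : Subring ℚ[X] where
  carrier := {f | ∀ α ∈ E, ∀ p : Nat.Primes,
    aeval (α p : ℚ_[(p : ℕ)]) f ∈ PadicInt.subring (p : ℕ)}
  mul_mem' hf hg α hα p := by
    rw [map_mul]; exact mul_mem (hf α hα p) (hg α hα p)
  one_mem' α _ p := by rw [map_one]; exact one_mem _
  add_mem' hf hg α hα p := by
    rw [map_add]; exact add_mem (hf α hα p) (hg α hα p)
  zero_mem' α _ p := by rw [map_zero]; exact zero_mem _
  neg_mem' hf α hα p := by
    rw [map_neg]; exact neg_mem (hf α hα p)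

/-- The compact subsets of `Ẑ` of the form `∏_p F_p` with each `F_p` closed in `ℤ_p`,
ordered by inclusion. -/
abbrev CompactProduct : Type :=
  {S : Set ZHat // IsCompact S ∧
    ∃ F : ∀ p : Nat.Primes, Set ℤ_[(p : ℕ)], (∀ p, IsClosed (F p)) ∧ S = Set.univ.pi F}

/-- The subset `∏_p Z_p(R)` of `Ẑ`. -/
def ZHatSet (R : PolyOverring) : Set ZHat := Set.univ.pi fun p => Zp p R

/-- The polynomial overrings `R` with `R = ℚ[X]` or `Z_p(R) ≠ ∅` for every prime `p`. -/
abbrev FullPolyOverring : Type :=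
  {R : PolyOverring // R.1 = ⊤ ∨ ∀ p : Nat.Primes, (Zp p R).Nonempty}

end IntPoly

/-! By Mahler's theorem `Int(ℤ)` is dense in `C(ℤ_p, ℤ_p)`, so the uniform closure of an overring
`R` in `C(ℤ_p, ℚ_p)` contains every continuous `ℤ_p`-valued function, in particular indicators of
clopen sets. This makes membership in `R` a pointwise question, one prime at a time.

`mem_Zp_iff`: `α ∈ Z_p(R)` iff every element of `R` is integral at `α`; a pole at `α` can be
cancelled by an element of `𝔐_{p,α}`. `intFamily_Zp`: if `f` is integral on `Z_p(R)`, compactness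
covers the rest of the set where `|f| > 1` by clopen sets on which the closure of `R` contains `p⁻¹`
times the indicator. So `f` lies in the closure for each `p`, and the local approximations are glued
by an ideal of `ℤ`. `Zp_intFamily`: a point outside a closed `F_p` is separated from it by a clopen
set, and `p⁻¹` times an approximate indicator detects it.

Subsets of `Ẑ` give nothing beyond this: an empty product gives `ℚ[X]`, a non-empty one has no empty
factor. -/

namespace IntPoly

/-- The binomial polynomial `X (X - 1) ⋯ (X - k + 1) / k!`. -/
noncomputable def binomPoly (k : ℕ) : ℚ[X] :=
  C ((k.factorial : ℚ)⁻¹) * (descPochhammer ℤ k).map (Int.castRingHom ℚ)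

theorem aeval_binomPoly {R A : Type*} [CommRing R] [BinomialRing R] [Field A] [Algebra ℚ A]
    (φ : R →+* A) (r : R) (k : ℕ) : aeval (φ r) (binomPoly k) = φ (Ring.choose r k) := by
  have : CharZero A := algebraRat.charZero A
  have h0 : (k.factorial : A) ≠ 0 := Nat.cast_ne_zero.mpr k.factorial_ne_zero
  have h1 : aeval (φ r) ((descPochhammer ℤ k).map (Int.castRingHom ℚ)) =
      φ ((descPochhammer ℤ k).smeval r) := by
    rw [← aeval_eq_smeval, show Int.castRingHom ℚ = algebraMap ℤ ℚ from rfl, aeval_map_algebraMap,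
      aeval_def, aeval_def, hom_eval₂]
    congr 1
    exact RingHom.ext_int _ _
  rw [binomPoly, map_mul, h1, Ring.descPochhammer_eq_factorial_smul_choose, aeval_C, map_nsmul,
    nsmul_eq_mul, ← mul_assoc, map_inv₀, map_natCast, inv_mul_cancel₀ h0, one_mul]

theorem binomPoly_mem_intZ (k : ℕ) : binomPoly k ∈ intZ := fun n =>
  ⟨Ring.choose n k, by
    simpa [coe_aeval_eq_eval] using aeval_binomPoly (Int.castRingHom ℚ) n k⟩

variable (p : ℕ) [Fact p.Prime]

/-! ### Uniform closures and Mahler density -/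

/-- A rational polynomial, as a continuous function `ℤ_p → ℚ_p`. -/
noncomputable def evalMap : ℚ[X] →+* C(ℤ_[p], ℚ_[p]) where
  toFun f := ⟨fun x => aeval (x : ℚ_[p]) f, f.continuous_aeval.comp continuous_subtype_val⟩
  map_one' := by ext; simp
  map_mul' f g := by ext; simp
  map_zero' := by ext; simp
  map_add' f g := by ext; simp

@[simp] theorem evalMap_apply (f : ℚ[X]) (x : ℤ_[p]) :
    evalMap p f x = aeval (x : ℚ_[p]) f := rfl

/-- The uniform closure of a ring of rational polynomials in `C(ℤ_p, ℚ_p)`. -/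
noncomputable def uniformClosure (R : Subring ℚ[X]) : Subring C(ℤ_[p], ℚ_[p]) :=
  (R.map (evalMap p)).topologicalClosure

variable {p}

theorem evalMap_mem_uniformClosure {R : Subring ℚ[X]} {f : ℚ[X]} (hf : f ∈ R) :
    evalMap p f ∈ uniformClosure p R :=
  Subring.le_topologicalClosure _ ⟨f, hf, rfl⟩

theorem uniformClosure_mono {R S : Subring ℚ[X]} (h : R ≤ S) :
    uniformClosure p R ≤ uniformClosure p S :=
  closure_mono (Set.image_mono h)

theorem mem_uniformClosure_iff {R : Subring ℚ[X]} {φ : C(ℤ_[p], ℚ_[p])} :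
    φ ∈ uniformClosure p R ↔ ∀ ε > 0, ∃ f ∈ R, ∀ x : ℤ_[p], ‖φ x - aeval (x : ℚ_[p]) f‖ < ε := by
  change φ ∈ closure (R.map (evalMap p) : Set C(ℤ_[p], ℚ_[p])) ↔ _
  rw [Metric.mem_closure_iff]
  refine forall₂_congr fun ε hε => ?_
  constructor
  · rintro ⟨_, ⟨f, hf, rfl⟩, h⟩
    refine ⟨f, hf, fun x => ?_⟩
    rw [← evalMap_apply, ← dist_eq_norm]
    exact (ContinuousMap.dist_apply_le_dist x).trans_lt h
  · rintro ⟨f, hf, h⟩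
    refine ⟨_, ⟨f, hf, rfl⟩, ?_⟩
    rw [ContinuousMap.dist_lt_iff hε]
    intro x
    rw [dist_eq_norm]
    exact h x

theorem const_mem_uniformClosure (R : Subring ℚ[X]) {a : ℚ_[p]} (ha : ‖a‖ ≤ 1) :
    ContinuousMap.const ℤ_[p] a ∈ uniformClosure p R := by
  rw [mem_uniformClosure_iff]
  intro ε hε
  obtain ⟨n, hn⟩ := Metric.denseRange_iff.1 (PadicInt.denseRange_natCast (p := p))
    (⟨a, ha⟩ : ℤ_[p]) ε hε
  refine ⟨n, natCast_mem R n, fun x => ?_⟩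
  rw [map_natCast]
  exact hn

/-- Mahler's theorem: the integer-valued polynomials are dense in `C(ℤ_p, ℤ_p)`. -/
theorem mem_uniformClosure_of_norm_le_one {R : Subring ℚ[X]} (hR : intZ ≤ R)
    {φ : C(ℤ_[p], ℚ_[p])} (hφ : ∀ x, ‖φ x‖ ≤ 1) : φ ∈ uniformClosure p R := by
  refine uniformClosure_mono hR ?_
  have hclosed : IsClosed (uniformClosure p intZ : Set C(ℤ_[p], ℚ_[p])) :=
    Subring.isClosed_topologicalClosure _
  have : IsBoundedSMul ℤ_[p] ℚ_[p] := .of_norm_smul_le fun a b => (norm_mul (a : ℚ_[p]) b).le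
  refine hclosed.mem_of_tendsto (PadicInt.hasSum_mahler φ) (.of_forall fun s => ?_)
  refine sum_mem fun n _ => ?_
  have h1 : PadicInt.mahlerTerm ((fwdDiff 1)^[n] φ 0) n =
      evalMap p (binomPoly n) * ContinuousMap.const ℤ_[p] ((fwdDiff 1)^[n] φ 0) := by
    ext x
    rw [PadicInt.mahlerTerm_apply, ContinuousMap.mul_apply, evalMap_apply]
    erw [aeval_binomPoly (PadicInt.Coe.ringHom (p := p)) x n]
    rfl
  rw [h1]
  refine mul_mem (evalMap_mem_uniformClosure (binomPoly_mem_intZ n))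
    (const_mem_uniformClosure _ ?_)
  exact (IsUltrametricDist.norm_fwdDiff_iter_apply_le 1 φ 0 n).trans
    ((ContinuousMap.norm_le _ zero_le_one).2 hφ)

/-- A polynomial that is integral on `ℤ_p` becomes integer-valued after multiplication by an
integer prime to `p`. -/
theorem exists_mul_mem_intZ {f : ℚ[X]} (hf : ∀ x : ℤ_[p], ‖aeval (x : ℚ_[p]) f‖ ≤ 1) :
    ∃ s : ℤ, ¬ (p : ℤ) ∣ s ∧ (s : ℚ[X]) * f ∈ intZ := by
  obtain ⟨d, hd, hdf⟩ := IsLocalization.integerNormalization_spec (nonZeroDivisors ℤ) f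
  have hd0 : d ≠ 0 := nonZeroDivisors.ne_zero hd
  have hp : Prime (p : ℤ) := Nat.prime_iff_prime_int.1 Fact.out
  -- Split a common denominator of `f` into its `p`-part and a part `s` prime to `p`; integrality on
  -- `ℤ_p` makes the `p`-part superfluous.
  obtain ⟨m, s, hs, rfl⟩ : ∃ m : ℕ, ∃ s : ℤ, ¬ (p : ℤ) ∣ s ∧ d = p ^ m * s := by
    obtain ⟨s, h1, h2⟩ := (FiniteMultiplicity.of_prime_left hp hd0).exists_eq_pow_mul_and_not_dvd
    exact ⟨_, s, h2, h1⟩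
  refine ⟨s, hs, fun n => ?_⟩
  set g := IsLocalization.integerNormalization (nonZeroDivisors ℤ) f with hg
  have h1 : ((p : ℚ) ^ m * s) * f.eval (n : ℚ) = (g.eval n : ℤ) := by
    have := congrArg (Polynomial.eval (n : ℚ)) hdf
    rw [algebraMap_int_eq, eval_intCast_map, zsmul_eq_mul, eval_mul, eval_intCast] at this
    simpa using this.symm
  have h2 : aeval (((n : ℤ_[p]) : ℚ_[p])) f = ((f.eval (n : ℚ) : ℚ) : ℚ_[p]) := by
    have h1 : (((n : ℤ_[p]) : ℚ_[p])) = algebraMap ℚ ℚ_[p] (n : ℚ) := by simp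
    rw [h1, aeval_algebraMap_apply, coe_aeval_eq_eval]
    simp
  have h3 := hf n
  rw [h2] at h3
  have h4 : ‖((g.eval n : ℤ) : ℚ_[p])‖ ≤ (p : ℝ) ^ (-(m : ℤ)) := by
    have : ((g.eval n : ℤ) : ℚ_[p]) = (p : ℚ_[p]) ^ m * (((s : ℤ) : ℚ_[p]) *
      ((f.eval (n : ℚ) : ℚ) : ℚ_[p])) := by
      have := congrArg (fun x : ℚ => (x : ℚ_[p])) h1
      push_cast at this
      rw [← this, mul_assoc]
    rw [this, norm_mul, norm_pow, Padic.norm_p, zpow_neg, zpow_natCast, inv_pow]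
    refine mul_le_of_le_one_right (by positivity) ?_
    rw [norm_mul]
    exact mul_le_one₀ (Padic.norm_int_le_one s) (norm_nonneg _) h3
  rw [Padic.norm_int_le_pow_iff_dvd] at h4
  obtain ⟨c, hc⟩ := h4
  refine ⟨c, ?_⟩
  have hp0 : (p : ℚ) ^ m ≠ 0 := pow_ne_zero _ (Nat.cast_ne_zero.2 (Fact.out : p.Prime).ne_zero)
  apply mul_left_cancel₀ hp0
  rw [eval_mul, eval_intCast, ← mul_assoc, h1, hc]
  push_cast
  rfl

/-! ### Clopen truncations -/

theorem continuous_indicator_of_isClopen {X Y : Type*} [TopologicalSpace X] [TopologicalSpace Y]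
    [Zero Y] {U : Set X} (hU : IsClopen U) {f : X → Y} (hf : ContinuousOn f U) :
    Continuous (U.indicator f) :=
  continuous_indicator (by simp [hU.frontier_eq]) (by rwa [hU.1.closure_eq])

theorem isClopen_norm_le_one (φ : C(ℤ_[p], ℚ_[p])) : IsClopen {x | ‖φ x‖ ≤ 1} := by
  have := (IsUltrametricDist.isClopen_closedBall (0 : ℚ_[p]) one_ne_zero).preimage φ.continuous
  convert this using 1
  ext x
  simp

theorem isClopen_one_lt_norm (φ : C(ℤ_[p], ℚ_[p])) : IsClopen {x | 1 < ‖φ x‖} := by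
  convert (isClopen_norm_le_one φ).compl using 1
  ext x
  simp

/-- The function `x ↦ φ(x)⁻¹` where `|φ(x)| > 1`, extended by zero. -/
noncomputable def truncatedInv (φ : C(ℤ_[p], ℚ_[p])) : C(ℤ_[p], ℚ_[p]) where
  toFun := {x | 1 < ‖φ x‖}.indicator fun x => (φ x)⁻¹
  continuous_toFun := continuous_indicator_of_isClopen (isClopen_one_lt_norm φ) <|
    φ.continuous.continuousOn.inv₀ fun _ hx => norm_pos_iff.1 (zero_lt_one.trans hx)

theorem truncatedInv_apply_of_lt {φ : C(ℤ_[p], ℚ_[p])} {x : ℤ_[p]} (hx : 1 < ‖φ x‖) :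
    truncatedInv φ x = (φ x)⁻¹ := 
  Set.indicator_of_mem (s := {x | 1 < ‖φ x‖}) hx fun x => (φ x)⁻¹

theorem truncatedInv_apply_of_le {φ : C(ℤ_[p], ℚ_[p])} {x : ℤ_[p]} (hx : ‖φ x‖ ≤ 1) :
    truncatedInv φ x = 0 := 
  Set.indicator_of_notMem (s := {x | 1 < ‖φ x‖}) hx.not_gt fun x => (φ x)⁻¹

theorem norm_truncatedInv_lt_one (φ : C(ℤ_[p], ℚ_[p])) (x : ℤ_[p]) : ‖truncatedInv φ x‖ < 1 := by
  rcases lt_or_ge 1 ‖φ x‖ with hx | hx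
  · rw [truncatedInv_apply_of_lt hx, norm_inv]
    exact inv_lt_one_of_one_lt₀ hx
  · rw [truncatedInv_apply_of_le hx, norm_zero]
    exact one_pos

theorem padic_norm_sub_le_max (x y : ℚ_[p]) : ‖x - y‖ ≤ max ‖x‖ ‖y‖ := by
  simpa only [sub_eq_add_neg, norm_neg] using IsUltrametricDist.norm_add_le_max x (-y)

theorem norm_le_inv_of_lt_one {x : ℚ_[p]} (hx : ‖x‖ < 1) : ‖x‖ ≤ (p : ℝ)⁻¹ := by
  have := (Padic.norm_le_pow_iff_norm_lt_pow_add_one x (-1)).2 (by simpa using hx)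
  simpa using this

/-- The function equal to a constant on a clopen set, and to zero elsewhere. -/
noncomputable def clopenConst {U : Set ℤ_[p]} (hU : IsClopen U) (a : ℚ_[p]) :
    C(ℤ_[p], ℚ_[p]) :=
  ⟨U.indicator fun _ => a, continuous_indicator_of_isClopen hU continuousOn_const⟩

theorem clopenConst_apply {U : Set ℤ_[p]} (hU : IsClopen U) (a : ℚ_[p]) (x : ℤ_[p]) :
    clopenConst hU a x = U.indicator (fun _ => a) x := rfl

theorem norm_clopenConst_one_le {U : Set ℤ_[p]} (hU : IsClopen U) (x : ℤ_[p]) :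
    ‖clopenConst hU 1 x‖ ≤ 1 := by
  rw [clopenConst_apply]
  exact (norm_indicator_le_norm_self _ _).trans norm_one.le

/-! ### Pointwise description of `Z_p(R)` -/

theorem mem_idealM_iff {α : ℤ_[p]} {f : intZ} :
    f ∈ idealM p α ↔ ‖aeval (α : ℚ_[p]) (f : ℚ[X])‖ < 1 := by
  constructor
  · rintro ⟨β, hβ⟩
    rw [hβ, norm_mul]
    exact mul_lt_one_of_nonneg_of_lt_one_left (norm_nonneg _) Padic.norm_p_lt_one β.2
  · intro h
    obtain ⟨β, hβ⟩ := (PadicInt.norm_lt_one_iff_dvd (⟨_, h.le⟩ : ℤ_[p])).1 h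
    exact ⟨β, by simpa using congrArg Subtype.val hβ⟩

/-- A point `α` belongs to `Z_p(R)` if and only if `R` is integral at `α`. -/
theorem mem_Zp_iff {R : PolyOverring} {α : ℤ_[p]} :
    α ∈ Zp p R ↔ ∀ f ∈ R.1, ‖aeval (α : ℚ_[p]) f‖ ≤ 1 := by
  constructor
  · intro hα r hr
    by_contra! hlt
    refine hα ?_
    set I := (idealM p α).map (Subring.inclusion R.2) with hI
    set ρ := evalMap p r with hρ
    -- Small enough that the error in approximating `truncatedInv ρ` stays below 1 after
    -- multiplication by `ρ`.
    have hε : 0 < (‖ρ‖ + 1)⁻¹ := by positivity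
    obtain ⟨a, ha, haε⟩ := mem_uniformClosure_iff.1 (mem_uniformClosure_of_norm_le_one le_rfl
      fun x => (norm_truncatedInv_lt_one ρ x).le) _ hε
    have hmul : ∀ x, ‖ρ x * truncatedInv ρ x - ρ x * aeval (x : ℚ_[p]) a‖ < 1 := by
      intro x
      rw [← mul_sub, norm_mul]
      calc _ ≤ ‖ρ‖ * ‖truncatedInv ρ x - aeval (x : ℚ_[p]) a‖ := by
            gcongr; exact ρ.norm_coe_le_norm x
        _ ≤ ‖ρ‖ * (‖ρ‖ + 1)⁻¹ := by gcongr; exact (haε x).le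
        _ < 1 := by
          rw [← div_eq_mul_inv, div_lt_one (by positivity)]
          exact lt_add_one _
    have hra : ∀ x : ℤ_[p], ‖aeval (x : ℚ_[p]) (r * a)‖ ≤ 1 := by
      intro x
      have h1 : aeval (x : ℚ_[p]) (r * a) = ρ x * truncatedInv ρ x -
          (ρ x * truncatedInv ρ x - ρ x * aeval (x : ℚ_[p]) a) := by
        rw [sub_sub_cancel, map_mul]; rfl
      rw [h1]
      refine (padic_norm_sub_le_max _ _).trans (max_le ?_ (hmul x).le)
      rcases lt_or_ge 1 ‖ρ x‖ with hx | hx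
      · rw [truncatedInv_apply_of_lt hx,
          mul_inv_cancel₀ (norm_pos_iff.1 (zero_lt_one.trans hx)), norm_one]
      · rw [truncatedInv_apply_of_le hx, mul_zero, norm_zero]
        exact zero_le_one
    obtain ⟨s, hs, hsra⟩ := exists_mul_mem_intZ hra
    have haM : ‖aeval (α : ℚ_[p]) a‖ < 1 := by
      have h1 : aeval (α : ℚ_[p]) a =
        truncatedInv ρ α - (truncatedInv ρ α - aeval (α : ℚ_[p]) a) := by ring
      rw [h1]
      refine (padic_norm_sub_le_max _ _).trans_lt
        (max_lt (norm_truncatedInv_lt_one ρ α) ((haε α).trans_le ?_))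
      exact inv_le_one_of_one_le₀ (by linarith [norm_nonneg ρ])
    have hunit : ‖aeval (α : ℚ_[p]) ((s : ℚ[X]) * (r * a))‖ = 1 := by
      have h2 := hmul α
      have hα0 : ρ α ≠ 0 := norm_pos_iff.1 (zero_lt_one.trans hlt)
      rw [truncatedInv_apply_of_lt hlt, mul_inv_cancel₀ hα0] at h2
      rw [map_mul, norm_mul, map_intCast]
      have h3 : ‖((s : ℤ) : ℚ_[p])‖ = 1 := by
        refine le_antisymm (Padic.norm_int_le_one s) (not_lt.1 fun h => hs ?_)
        exact (Padic.norm_intCast_lt_one_iff (k := s)).1 h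
      rw [h3, one_mul, map_mul]
      have h4 := IsUltrametricDist.norm_eq_of_add_norm_lt_max
        (x := (1 : ℚ_[p])) (y := -(ρ α * aeval (α : ℚ_[p]) a))
        (by rw [← sub_eq_add_neg, norm_one]; exact h2.trans_le (le_max_left _ _))
      rw [norm_neg, norm_one] at h4
      exact h4.symm
    -- `s * r * a` is in `I` because `a ∈ 𝔐_{p,α}`, yet is a unit at `α`. Subtracting its residue
    -- `c` gives an element of `𝔐_{p,α}`, so `I` contains the coprime integers `p` and `c`.
    obtain ⟨c, -, hc⟩ := PadicInt.exists_mem_range (⟨_, hunit.le⟩ : ℤ_[p])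
    rw [IsLocalRing.mem_maximalIdeal, PadicInt.mem_nonunits] at hc
    have hc' : ‖aeval (α : ℚ_[p]) ((s : ℚ[X]) * (r * a)) - (c : ℚ_[p])‖ < 1 := hc
    have hpc : ¬ (p : ℤ) ∣ (c : ℤ) := by
      intro hdvd
      have h5 : ‖(c : ℚ_[p])‖ < 1 := by
        have := (Padic.norm_intCast_lt_one_iff (p := p) (k := (c : ℤ))).2 hdvd
        simpa using this
      have h6 := (IsUltrametricDist.norm_add_le_max _ _).trans_lt (max_lt hc' h5)
      rw [sub_add_cancel, hunit] at h6
      exact lt_irrefl _ h6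
    have hmap : ∀ g (hg : g ∈ intZ), ‖aeval (α : ℚ_[p]) g‖ < 1 → (⟨g, R.2 hg⟩ : R.1) ∈ I :=
      fun g hg h => Ideal.mem_map_of_mem (Subring.inclusion R.2)
        ((mem_idealM_iff (f := ⟨g, hg⟩)).2 h)
    have hbI : (⟨(s : ℚ[X]) * (r * a), R.2 hsra⟩ : R.1) ∈ I := by
      have := I.mul_mem_left ⟨(s : ℚ[X]) * r, mul_mem (intCast_mem _ s) hr⟩ (hmap a ha haM)
      convert this using 1
      exact Subtype.ext (mul_assoc _ _ _).symm
    have hbcI := hmap ((s : ℚ[X]) * (r * a) - (c : ℚ[X])) (sub_mem hsra (natCast_mem _ c))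
      (by rw [map_sub, map_natCast]; exact hc')
    have hpI := hmap (p : ℚ[X]) (natCast_mem _ p) (by rw [map_natCast]; exact Padic.norm_p_lt_one)
    have hcI : ((c : ℤ) : R.1) ∈ I := by
      convert I.sub_mem hbI hbcI using 1
      apply Subtype.ext
      push_cast
      ring
    obtain ⟨u, v, huv⟩ : IsCoprime (p : ℤ) (c : ℤ) :=
      (Nat.prime_iff_prime_int.1 Fact.out).irreducible.coprime_iff_not_dvd.2 hpc
    rw [Ideal.eq_top_iff_one]
    have h7 : (1 : R.1) = (u : R.1) * ((p : ℤ) : R.1) + (v : R.1) * ((c : ℤ) : R.1) := by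
      exact_mod_cast congrArg (Int.cast : ℤ → R.1) huv.symm
    rw [h7]
    refine I.add_mem (I.mul_mem_left _ ?_) (I.mul_mem_left _ hcI)
    convert hpI using 1
    apply Subtype.ext
    push_cast
    rfl
  · intro h htop
    -- Integrality at `α` makes this an ideal of `R`; it is proper and contains `𝔐_{p,α} R`.
    let K : Ideal R.1 :=
      { carrier := {f | ‖aeval (α : ℚ_[p]) (f : ℚ[X])‖ < 1}
        add_mem' := fun {f g} hf hg => by
          simp only [Set.mem_ofPred_eq, Subring.coe_add, map_add] at *
          exact (IsUltrametricDist.norm_add_le_max _ _).trans_lt (max_lt hf hg)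
        zero_mem' := by simp
        smul_mem' := fun c f hf => by
          simp only [Set.mem_ofPred_eq, smul_eq_mul, Subring.coe_mul, map_mul, norm_mul] at *
          exact mul_lt_one_of_nonneg_of_lt_one_right (h c c.2) (norm_nonneg _) hf }
    have hK : (idealM p α).map (Subring.inclusion R.2) ≤ K :=
      Ideal.map_le_iff_le_comap.2 fun f hf => mem_idealM_iff.1 hf
    have h1 : (1 : R.1) ∈ K := hK (htop ▸ Submodule.mem_top)
    have h2 : ‖aeval (α : ℚ_[p]) (1 : ℚ[X])‖ < 1 := h1
    rw [map_one, norm_one] at h2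
    exact lt_irrefl _ h2

theorem Zp_eq_iInter (R : PolyOverring) :
    Zp p R = ⋂ f ∈ R.1, {α | ‖evalMap p f α‖ ≤ 1} := by
  ext α
  rw [mem_Zp_iff]
  simp

theorem isClosed_Zp (R : PolyOverring) : IsClosed (Zp p R) := by
  rw [Zp_eq_iInter]
  exact isClosed_biInter fun f _ => (isClopen_norm_le_one _).1

theorem Zp_antitone {R S : PolyOverring} (h : R ≤ S) : Zp p S ⊆ Zp p R := fun _ hα =>
  mem_Zp_iff.2 fun f hf => mem_Zp_iff.1 hα f (h hf)

/-! ### Recovering `R` from the sets `Z_p(R)` -/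

/-- Around a point outside `Z_p(R)`, some bump function of height `p⁻¹` is a uniform limit of
polynomials from `R`. -/
theorem exists_clopenConst_mem_uniformClosure (R : PolyOverring) {K : Set ℤ_[p]}
    (hK : IsCompact K) (hKR : Disjoint K (Zp p R)) :
    ∃ (U : Set ℤ_[p]) (hU : IsClopen U), K ⊆ U ∧
      clopenConst hU (p : ℚ_[p])⁻¹ ∈ uniformClosure p R.1 := by
  have hp0 : (p : ℚ_[p]) ≠ 0 := Nat.cast_ne_zero.2 (Fact.out : p.Prime).ne_zero
  refine hK.induction_on (p := fun K => ∃ (U : Set ℤ_[p]) (hU : IsClopen U), K ⊆ U ∧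
      clopenConst hU (p : ℚ_[p])⁻¹ ∈ uniformClosure p R.1) ?_ ?_ ?_ ?_
  · refine ⟨∅, isClopen_empty, subset_rfl, ?_⟩
    convert zero_mem (uniformClosure p R.1) using 1
    ext x
    simp [clopenConst_apply]
  · rintro s t hst ⟨U, hU, htU, h⟩
    exact ⟨U, hU, hst.trans htU, h⟩
  · rintro s t ⟨U, hU, hsU, hU'⟩ ⟨V, hV, htV, hV'⟩
    refine ⟨U ∪ V, hU.union hV, Set.union_subset_union hsU htV, ?_⟩
    -- The indicator of `U ∪ V` is `1_U + 1_V * 1_{Uᶜ}`.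
    convert add_mem hU' (mul_mem hV' (mem_uniformClosure_of_norm_le_one R.2
      (norm_clopenConst_one_le hU.compl))) using 1
    ext x
    by_cases h1 : x ∈ U <;> by_cases h2 : x ∈ V <;> simp [clopenConst_apply, h1, h2]
  · intro x hx
    have hxR : x ∉ Zp p R := fun h => Set.disjoint_left.1 hKR hx h
    rw [mem_Zp_iff] at hxR
    push Not at hxR
    obtain ⟨r, hr, hlt⟩ := hxR
    have hU := isClopen_one_lt_norm (evalMap p r)
    refine ⟨_, mem_nhdsWithin_of_mem_nhds (hU.isOpen.mem_nhds hlt), _, hU, subset_rfl, ?_⟩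
    -- The value group is discrete: norm below 1 means at most `p⁻¹`, which leaves room for the
    -- factor `p⁻¹`.
    have hψ : ∀ y, ‖(ContinuousMap.const ℤ_[p] (p : ℚ_[p])⁻¹ *
        truncatedInv (evalMap p r)) y‖ ≤ 1 := by
      intro y
      rw [ContinuousMap.mul_apply, ContinuousMap.const_apply, norm_mul, norm_inv, Padic.norm_p,
        inv_inv]
      have := norm_le_inv_of_lt_one (norm_truncatedInv_lt_one (evalMap p r) y)
      have hp : (0 : ℝ) < p := Nat.cast_pos.2 (Fact.out : p.Prime).pos
      calc _ ≤ (p : ℝ) * (p : ℝ)⁻¹ := by gcongr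
        _ = 1 := mul_inv_cancel₀ hp.ne'
    convert mul_mem (evalMap_mem_uniformClosure hr)
      (mem_uniformClosure_of_norm_le_one R.2 hψ) using 1
    ext y
    rw [clopenConst_apply, ContinuousMap.mul_apply, ContinuousMap.mul_apply,
      ContinuousMap.const_apply]
    rcases lt_or_ge 1 ‖evalMap p r y‖ with hy | hy
    · rw [Set.indicator_of_mem (s := {x | 1 < ‖evalMap p r x‖}) hy, truncatedInv_apply_of_lt hy]
      rw [mul_left_comm, mul_inv_cancel₀ (norm_pos_iff.1 (zero_lt_one.trans hy)), mul_one]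
    · rw [Set.indicator_of_notMem (s := {x | 1 < ‖evalMap p r x‖}) hy.not_gt,
        truncatedInv_apply_of_le hy, mul_zero, mul_zero]

/-- With `W = {|φ| ≤ 1}` and `U ⊇ Wᶜ` carrying a bump of height `p⁻¹`, write `φ = 1_W φ + (p⁻¹
1_U)^m * (p^m 1_{Wᶜ} φ)`. For large `m` the functions `1_W φ` and `p^m 1_{Wᶜ} φ` are integral. -/
theorem evalMap_mem_uniformClosure_of_integral {R : PolyOverring} {f : ℚ[X]}
    (hf : f ∈ intQp p (Zp p R)) : evalMap p f ∈ uniformClosure p R.1 := by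
  set φ := evalMap p f with hφ
  have hp0 : (p : ℚ_[p]) ≠ 0 := Nat.cast_ne_zero.2 (Fact.out : p.Prime).ne_zero
  have hW := isClopen_norm_le_one φ
  set W := {x | ‖φ x‖ ≤ 1} with hWdef
  obtain ⟨U, hU, hWU, hUR⟩ := exists_clopenConst_mem_uniformClosure R
    hW.compl.1.isCompact (Set.disjoint_left.2 fun x hx hxR => hx (hf x hxR))
  obtain ⟨m, hm⟩ : ∃ m : ℕ, ‖φ‖ ≤ (p : ℝ) ^ m :=
    pow_unbounded_of_one_lt ‖φ‖ (Nat.one_lt_cast.2 (Fact.out : p.Prime).one_lt) |>.imp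
      fun _ h => h.le
  have h1 : ∀ x, ‖(clopenConst hW 1 * φ) x‖ ≤ 1 := by
    intro x
    rw [ContinuousMap.mul_apply, clopenConst_apply]
    by_cases hx : x ∈ W
    · rw [Set.indicator_of_mem hx, one_mul]
      exact hx
    · rw [Set.indicator_of_notMem hx, zero_mul, norm_zero]
      exact zero_le_one
  have h2 : ∀ x, ‖(ContinuousMap.const ℤ_[p] ((p : ℚ_[p]) ^ m) *
      clopenConst hW.compl 1 * φ) x‖ ≤ 1 := by
    intro x
    have hp : (0 : ℝ) < p := Nat.cast_pos.2 (Fact.out : p.Prime).pos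
    rw [ContinuousMap.mul_apply, ContinuousMap.mul_apply, ContinuousMap.const_apply, norm_mul,
      norm_mul, norm_pow, Padic.norm_p]
    calc _ ≤ (p : ℝ)⁻¹ ^ m * 1 * (p : ℝ) ^ m := by
          gcongr
          · exact norm_clopenConst_one_le _ x
          · exact (φ.norm_coe_le_norm x).trans hm
      _ = 1 := by rw [mul_one, ← mul_pow, inv_mul_cancel₀ hp.ne', one_pow]
  convert add_mem (mem_uniformClosure_of_norm_le_one R.2 h1) (mul_mem (pow_mem hUR m)
    (mem_uniformClosure_of_norm_le_one R.2 h2)) using 1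
  ext x
  simp only [ContinuousMap.add_apply, ContinuousMap.mul_apply, ContinuousMap.pow_apply,
    ContinuousMap.const_apply, clopenConst_apply]
  by_cases hx : x ∈ W
  · simp [hx]
  · rw [Set.indicator_of_notMem hx, Set.indicator_of_mem (hWU hx),
      Set.indicator_of_mem (s := Wᶜ) hx, inv_pow]
    field_simp
    ring

theorem intFamily_Zp (R : PolyOverring) :
    intFamily (fun p : Nat.Primes => Zp (p : ℕ) R) = R.1 := by
  refine le_antisymm (fun f hf => ?_) (fun f hf => ?_)
  · simp only [intFamily, Subring.mem_iInf] at hf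
    -- The integers carrying `f` into `R`. Near each `p`, some `h ∈ R` has `f - h` integral on
    -- `ℤ_p`, which gives an element of `J` prime to `p`.
    let J : Ideal ℤ :=
      { carrier := {s | (s : ℚ[X]) * f ∈ R.1}
        add_mem' := fun {s t} hs ht => by
          simp only [Set.mem_ofPred_eq, Int.cast_add, add_mul] at *
          exact add_mem hs ht
        zero_mem' := by simp
        smul_mem' := fun c s hs => by
          simp only [Set.mem_ofPred_eq, smul_eq_mul, Int.cast_mul, mul_assoc] at *
          exact mul_mem (intCast_mem _ c) hs }
    have hJ : ∀ s : ℤ, s ∈ J ↔ (s : ℚ[X]) * f ∈ R.1 := fun _ => Iff.rfl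
    suffices J = ⊤ by
      have h1 : (1 : ℤ) ∈ J := this ▸ Submodule.mem_top
      rw [hJ, Int.cast_one, one_mul] at h1
      exact h1
    have key : ∀ p : Nat.Primes, ∃ s ∈ J, ¬ ((p : ℕ) : ℤ) ∣ s := by
      intro p
      obtain ⟨h, hR, hh⟩ := mem_uniformClosure_iff.1
        (evalMap_mem_uniformClosure_of_integral (hf p)) 1 one_pos
      obtain ⟨s, hs, hsf⟩ := exists_mul_mem_intZ (p := p) (f := f - h)
        fun x => by rw [map_sub]; exact (hh x).le
      refine ⟨s, ?_, hs⟩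
      rw [hJ]
      have := add_mem (R.2 hsf) (mul_mem (intCast_mem R.1 s) hR)
      rwa [← mul_add, sub_add_cancel] at this
    obtain ⟨d, hd⟩ := (IsPrincipalIdealRing.principal J).principal
    by_contra hne
    have hd1 : d.natAbs ≠ 1 := by
      intro h
      refine hne ?_
      rw [hd]
      exact Ideal.span_singleton_eq_top.2 (Int.isUnit_iff_natAbs_eq.2 h)
    obtain ⟨q, hq, hqd⟩ := Nat.exists_prime_and_dvd hd1
    obtain ⟨s, hs, hqs⟩ := key ⟨q, hq⟩
    rw [hd] at hs
    exact hqs ((Int.natCast_dvd.2 hqd).trans (Ideal.mem_span_singleton.1 hs))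
  · simp only [intFamily, Subring.mem_iInf]
    exact fun p α hα => mem_Zp_iff.1 hα f hf

/-! ### Recovering closed sets from their rings -/

theorem intZ_le_intFamily (F : ∀ p : Nat.Primes, Set ℤ_[(p : ℕ)]) : intZ ≤ intFamily F := by
  intro f hf
  simp only [intFamily, Subring.mem_iInf]
  exact fun p α _ => aeval_mem_of_mem_intZ p hf α

theorem intFamily_antitone {F G : ∀ p : Nat.Primes, Set ℤ_[(p : ℕ)]} (h : ∀ p, F p ⊆ G p) :
    intFamily G ≤ intFamily F := by
  intro f hf
  simp only [intFamily, Subring.mem_iInf] at *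
  exact fun p α hα => hf p α (h p hα)

theorem Zp_intFamily {F : ∀ p : Nat.Primes, Set ℤ_[(p : ℕ)]} (hF : ∀ p, IsClosed (F p))
    (p : Nat.Primes) : Zp (p : ℕ) ⟨intFamily F, intZ_le_intFamily F⟩ = F p := by
  have hp : (p : ℕ).Prime := p.2
  ext α
  rw [mem_Zp_iff]
  refine ⟨fun h => ?_, fun hα f hf => ?_⟩
  · by_contra hα
    obtain ⟨U, hU, hαU, hUF⟩ := compact_exists_isClopen_in_isOpen (hF p).isOpen_compl hα
    -- `p⁻¹ * e` is integral on `F_p`, where `|e| < p⁻¹`, and at all primes `q ≠ p`, where `p` is a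
    -- unit; but not at `α`, where `e` is close to 1.
    obtain ⟨e, he, hue⟩ := mem_uniformClosure_iff.1 (mem_uniformClosure_of_norm_le_one le_rfl
      (norm_clopenConst_one_le hU)) ((p : ℕ) : ℝ)⁻¹ (inv_pos.2 (Nat.cast_pos.2 hp.pos))
    have hval : ∀ q : Nat.Primes, ∀ x : ℤ_[(q : ℕ)],
        ‖aeval (x : ℚ_[(q : ℕ)]) (C (((p : ℕ) : ℚ)⁻¹) * e)‖ =
          ‖((p : ℕ) : ℚ_[(q : ℕ)])‖⁻¹ * ‖aeval (x : ℚ_[(q : ℕ)]) e‖ := by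
      intro q x
      rw [map_mul, aeval_C, map_inv₀, map_natCast, norm_mul, norm_inv]
    have hmem : C (((p : ℕ) : ℚ)⁻¹) * e ∈ intFamily F := by
      simp only [intFamily, Subring.mem_iInf]
      intro q x hx
      change ‖_‖ ≤ (1 : ℝ)
      rw [hval]
      by_cases hqp : q = p
      · subst hqp
        have h1 := hue x
        rw [clopenConst_apply, Set.indicator_of_notMem fun hxU => hUF hxU hx, zero_sub,
          norm_neg] at h1
        rw [Padic.norm_p, inv_inv]
        have hq : (0 : ℝ) < (q : ℕ) := Nat.cast_pos.2 hp.pos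
        calc _ ≤ ((q : ℕ) : ℝ) * ((q : ℕ) : ℝ)⁻¹ := by gcongr
          _ = 1 := mul_inv_cancel₀ hq.ne'
      · have h1 : ‖((p : ℕ) : ℚ_[(q : ℕ)])‖ = 1 := by
          rw [Padic.norm_natCast_eq_one_iff]
          exact (Nat.coprime_primes q.2 hp).2 fun h => hqp (Subtype.ext h)
        rw [h1, inv_one, one_mul]
        exact aeval_mem_of_mem_intZ q he x
    have h2 := h _ hmem
    rw [hval, Padic.norm_p, inv_inv] at h2
    have h3 := hue α
    rw [clopenConst_apply, Set.indicator_of_mem hαU] at h3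
    have hp1 : (1 : ℝ) < (p : ℕ) := Nat.one_lt_cast.2 hp.one_lt
    have h4 : ‖aeval (α : ℚ_[(p : ℕ)]) e‖ < 1 := by
      by_contra! h5
      nlinarith
    have h6 := IsUltrametricDist.norm_add_le_max (1 - aeval (α : ℚ_[(p : ℕ)]) e) (aeval (α : ℚ_[(p : ℕ)]) e)
    rw [sub_add_cancel, norm_one] at h6
    exact absurd (h6.trans_lt (max_lt (h3.trans (inv_lt_one_of_one_lt₀ hp1)) h4)) (lt_irrefl _)
  · simp only [intFamily, Subring.mem_iInf] at hf
    exact hf p α hα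

/-! ### Subsets of `Ẑ` -/

theorem intQHat_pi {F : ∀ p : Nat.Primes, Set ℤ_[(p : ℕ)]} (hF : ∀ p, (F p).Nonempty) :
    intQHat (Set.univ.pi F) = intFamily F := by
  ext f
  simp only [intFamily, Subring.mem_iInf]
  refine ⟨fun h p α hα => ?_, fun h α hα p => h p (α p) (hα p trivial)⟩
  classical
  choose β hβ using hF
  -- Non-emptiness of the other factors extends `α` to a point of the product.
  have := h (Function.update β p α) (fun q _ => by
    by_cases hq : q = p
    · subst hq
      rwa [Function.update_self]
    · rw [Function.update_of_ne hq]
      exact hβ q) p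
  rwa [Function.update_self] at this

theorem intQHat_empty : intQHat ∅ = ⊤ :=
  eq_top_iff.2 fun _ _ _ hα => hα.elim

theorem intQHat_antitone {E E' : Set ZHat} (h : E ⊆ E') : intQHat E' ≤ intQHat E :=
  fun _ hf α hα => hf α (h hα)

theorem intZ_le_intQHat (E : Set ZHat) : intZ ≤ intQHat E :=
  fun _ hf α _ p => aeval_mem_of_mem_intZ p hf (α p)

theorem Zp_eq_empty_of_eq_top {R : PolyOverring} (hR : R.1 = ⊤) : Zp p R = ∅ := by
  refine Set.eq_empty_of_forall_notMem fun α hα => ?_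
  have hp := (Fact.out : p.Prime)
  have := mem_Zp_iff.1 hα (C ((p : ℚ)⁻¹)) (hR ▸ Subring.mem_top _)
  rw [aeval_C, map_inv₀, map_natCast, norm_inv, Padic.norm_p, inv_inv] at this
  exact absurd this (not_le.2 (Nat.one_lt_cast.2 hp.one_lt))

theorem ZHatSet_eq_empty_of_eq_top {R : PolyOverring} (hR : R.1 = ⊤) : ZHatSet R = ∅ :=
  Set.univ_pi_eq_empty (i := ⟨2, Nat.prime_two⟩) (Zp_eq_empty_of_eq_top hR)

theorem ZHatSet_antitone {R S : PolyOverring} (h : R ≤ S) : ZHatSet S ⊆ ZHatSet R :=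
  Set.pi_mono fun _ _ => Zp_antitone h

theorem intQHat_ZHatSet {R : PolyOverring}
    (hR : R.1 = ⊤ ∨ ∀ p : Nat.Primes, (Zp p R).Nonempty) : intQHat (ZHatSet R) = R.1 := by
  rcases hR with hR | hR
  · rw [ZHatSet_eq_empty_of_eq_top hR, intQHat_empty, hR]
  · rw [ZHatSet, intQHat_pi hR, intFamily_Zp]

/-- The ring `Int_ℚ(E, Ẑ)`, as a polynomial overring. -/
noncomputable def hatOverring (E : Set ZHat) : PolyOverring := ⟨intQHat E, intZ_le_intQHat E⟩

theorem hatOverring_full (E : Set ZHat) :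
    (hatOverring E).1 = ⊤ ∨ ∀ p : Nat.Primes, (Zp p (hatOverring E)).Nonempty := by
  rcases E.eq_empty_or_nonempty with rfl | ⟨α, hα⟩
  · exact .inl intQHat_empty
  · exact .inr fun p => ⟨α p, mem_Zp_iff.2 fun f hf => hf α hα p⟩

theorem ZHatSet_hatOverring {F : ∀ p : Nat.Primes, Set ℤ_[(p : ℕ)]} (hF : ∀ p, IsClosed (F p)) :
    ZHatSet (hatOverring (Set.univ.pi F)) = Set.univ.pi F := by
  rcases (Set.univ.pi F).eq_empty_or_nonempty with h | h
  · rw [h]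
    exact ZHatSet_eq_empty_of_eq_top intQHat_empty
  · have h1 : hatOverring (Set.univ.pi F) = ⟨intFamily F, intZ_le_intFamily F⟩ :=
      Subtype.ext (intQHat_pi (Set.univ_pi_nonempty_iff.1 h))
    rw [h1]
    exact Set.pi_congr rfl fun p _ => Zp_intFamily hF p

theorem isClosed_ZHatSet (R : PolyOverring) : IsClosed (ZHatSet R) :=
  isClosed_set_pi fun _ _ => isClosed_Zp R

/-- Polynomial overrings correspond to families of closed subsets of the `ℤ_p`. -/
noncomputable def formalProductEquiv :
    PolyOverring ≃o (∀ p : Nat.Primes, TopologicalSpace.Closeds ℤ_[(p : ℕ)])ᵒᵈ :=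
  Equiv.toOrderIso
    { toFun := fun R => OrderDual.toDual fun p => ⟨Zp p R, isClosed_Zp R⟩
      invFun := fun F => ⟨intFamily fun p => (OrderDual.ofDual F p : Set ℤ_[(p : ℕ)]),
        intZ_le_intFamily _⟩
      left_inv := fun R => Subtype.ext (intFamily_Zp R)
      right_inv := fun F => funext fun p => TopologicalSpace.Closeds.ext
        (Zp_intFamily (fun p => (OrderDual.ofDual F p).isClosed) p) }
    (fun _ _ h _ => Zp_antitone h)
    (fun _ _ h => intFamily_antitone h)

/-- Full polynomial overrings correspond to compact products in `Ẑ`. -/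
noncomputable def compactProductEquiv : FullPolyOverring ≃o CompactProductᵒᵈ :=
  Equiv.toOrderIso
    { toFun := fun R => OrderDual.toDual ⟨ZHatSet R.1, (isClosed_ZHatSet R.1).isCompact,
        _, fun _ => isClosed_Zp R.1, rfl⟩
      invFun := fun F => ⟨hatOverring (OrderDual.ofDual F).1, hatOverring_full _⟩
      left_inv := fun R => Subtype.ext (Subtype.ext (intQHat_ZHatSet R.2))
      right_inv := by
        rintro ⟨S, hS, F, hF, rfl⟩
        exact Subtype.ext (ZHatSet_hatOverring hF) }
    (fun _ _ h => ZHatSet_antitone h)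
    (fun _ _ h => intQHat_antitone h)

end IntPoly

theorem theorem6p2 :
    -- The correspondence for all polynomial overrings, with formal products of closed sets.
    (∃ e : IntPoly.PolyOverring ≃o
        (∀ p : Nat.Primes, TopologicalSpace.Closeds ℤ_[(p : ℕ)])ᵒᵈ,
      (∀ (R : IntPoly.PolyOverring) (p : Nat.Primes),
        (OrderDual.ofDual (e R) p : Set ℤ_[(p : ℕ)]) = IntPoly.Zp p R) ∧
      (∀ F : ∀ p : Nat.Primes, TopologicalSpace.Closeds ℤ_[(p : ℕ)],
        (e.symm (OrderDual.toDual F)).1 = IntPoly.intFamily fun p => (F p : Set ℤ_[(p : ℕ)]))) ∧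
    -- Formal products without empty factor give the same ring as the actual subset of `Ẑ`.
    (∀ F : ∀ p : Nat.Primes, Set ℤ_[(p : ℕ)], (∀ p, (F p).Nonempty) →
      IntPoly.intQHat (Set.univ.pi F) = IntPoly.intFamily F) ∧
    -- The correspondence with the compact subsets of `Ẑ` that are products of closed sets.
    (∃ e : IntPoly.FullPolyOverring ≃o IntPoly.CompactProductᵒᵈ,
      (∀ R : IntPoly.FullPolyOverring,
        (OrderDual.ofDual (e R)).1 = IntPoly.ZHatSet R.1) ∧
      (∀ F : IntPoly.CompactProduct,
        (e.symm (OrderDual.toDual F)).1.1 = IntPoly.intQHat F.1)) ∧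
    -- The polynomial overrings that are rings of integer-valued polynomials on a subset of `Ẑ`.
    (∀ R : IntPoly.PolyOverring,
      (∃ E : Set IntPoly.ZHat, R.1 = IntPoly.intQHat E) ↔
        (R.1 = ⊤ ∨ ∀ p : Nat.Primes, (IntPoly.Zp p R).Nonempty)) := by
  refine ⟨⟨IntPoly.formalProductEquiv, fun _ _ => rfl, fun _ => rfl⟩,
    fun _ hF => IntPoly.intQHat_pi hF,
    ⟨IntPoly.compactProductEquiv, fun _ => rfl, fun _ => rfl⟩, fun R => ⟨?_, fun hR =>
      ⟨_, (IntPoly.intQHat_ZHatSet hR).symm⟩⟩⟩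
  rintro ⟨E, hE⟩
  obtain rfl : R = IntPoly.hatOverring E := Subtype.ext hE
  exact IntPoly.hatOverring_full E
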